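/- Let $\beta_1,\beta_2,\dots$ be nonzero real numbers and let $X_1,X_2,\dots$ be mutually independent random variables on a probability space such that $X_i$ is exponentially distributed with rate $1/\beta_i^2$ (density $\beta_i^{-2}e^{-x/\beta_i^2}$ on $x\ge 0$). For $N\ge 1$ put $$\lambda_N=\sum_{i=1}^N X_i,\qquad \mu_N=\sum_{i=1}^N\beta_i^2,\qquad \sigma_N^2=\sum_{i=1}^N\beta_i^4,$$ and assume that no single variance dominates the total variance, i.e. $\max_{1\le i\le N}\beta_i^4/\sigma_N^2\to 0$ as $N\to\infty$. Then: 1. Each $X_i$ is square integrable with $\mathbb E[X_i]=\beta_i^2$ and $\operatorname{Var}(X_i)=\beta_i^4$; consequently $\mathbb E[\lambda_N]=\mu_N$ and $\operatorname{Var}(\lambda_N)=\sigma_N^2$ for every $N$. 2. The Lindeberg condition holds: for every $\varepsilon>0$, $$\lim_{N\to\infty}\frac1{\sigma_N^2}\sum_{i=1}^N\mathbb E\left[(X_i-\beta_i^2)^2\,\mathbf 1_{\{|X_i-\beta_i^2|>\varepsilon\sigma_N\}}\right]=0.$$ 3. The normalized sum $Z_N=(\lambda_N-\mu_N)/\sigma_N$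 converges in distribution to $\mathcal N(0,1)$. 4. $\lambda_N$ is asymptotically $\mathcal N(\mu_N,\sigma_N^2)$: writing $G_N$ for the distribution function of $\mathcal N(\mu_N,\sigma_N^2)$, $\sup_{y\in\mathbb R}|\mathbb P(\lambda_N\le y)-G_N(y)|\to 0$ as $N\to\infty$. 5. For every $N\ge1$ the variable $\lambda_N$ has a probability density $f_{\lambda_N}$, and it is approximated by the Gaussian density in the sense that, as $N\to\infty$, $$\sigma_N\cdot\operatorname*{ess\,sup}_{y\in\mathbb R}\left|f_{\lambda_N}(y)-\frac1{\sqrt{2\pi\sigma_N^2}}\exp\left(-\frac{(y-\mu_N)^2}{2\sigma_N^2}\right)\right|\to 0.$$ -/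

import Mathlib

open MeasureTheory ProbabilityTheory Filter Topology
open scoped ENNReal NNReal

/-- The partial sum of the first `N` terms of a sequence of random variables. -/
noncomputable def partialSum {Ω : Type*} (X : ℕ → Ω → ℝ) (N : ℕ) (ω : Ω) : ℝ :=
  ∑ i ∈ Finset.range N, X i ω

/-- The sum `s_N ^ 2` of the variances of the first `N` terms. -/
noncomputable def sumVariance {Ω : Type*} [MeasurableSpace Ω] (P : Measure Ω)
    (X : ℕ → Ω → ℝ) (N : ℕ) : ℝ :=
  ∑ i ∈ Finset.range N, variance (X i) P

/-- The centred and normalized partial sum `Z_N = (1 / s_N) ∑ (X_i - E X_i)`. -/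
noncomputable def normalizedSum {Ω : Type*} [MeasurableSpace Ω] (P : Measure Ω)
    (X : ℕ → Ω → ℝ) (N : ℕ) (ω : Ω) : ℝ :=
  (1 / √(sumVariance P X N)) * ∑ i ∈ Finset.range N, (X i ω - ∫ ω', X i ω' ∂P)

/-- The Lindeberg condition: for every `ε > 0`,
`(1 / s_N ^ 2) ∑ E[(X_i - E X_i) ^ 2 ; |X_i - E X_i| > ε s_N] → 0` as `N → ∞`. -/
def LindebergCondition {Ω : Type*} [MeasurableSpace Ω] (P : Measure Ω)
    (X : ℕ → Ω → ℝ) : Prop :=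
  ∀ ε : ℝ, 0 < ε →
    Tendsto (fun N : ℕ =>
      (1 / sumVariance P X N) * ∑ i ∈ Finset.range N,
        ∫ ω, Set.indicator {ω | ε * √(sumVariance P X N) < |X i ω - ∫ ω', X i ω' ∂P|}
          (fun ω => (X i ω - ∫ ω', X i ω' ∂P) ^ 2) ω ∂P)
      atTop (𝓝 0)

/-- The mean `∑_{i < N} β_i ^ 2` of the approximating Gaussian. -/
noncomputable def gaussMean (β : ℕ → ℝ) (N : ℕ) : ℝ :=
  ∑ i ∈ Finset.range N, β i ^ 2

/-- The variance `∑_{i < N} β_i ^ 4` of the approximating Gaussian. -/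
noncomputable def gaussVar (β : ℕ → ℝ) (N : ℕ) : ℝ :=
  ∑ i ∈ Finset.range N, β i ^ 4

/-! Put `c i = β i ^ 2 / σ_N`, so that `∑ c i ^ 2 = 1` and, by the domination hypothesis, `max c i →
0`. The normalized sum has characteristic function `φ_N t = ∏ exp (-i t c_j) / (1 - i t c_j)`.
Expanding logarithms to second order gives `φ_N t → exp (-t ^ 2 / 2)`, hence the central limit
theorem (`tendsto_expSumCharFun`).

For densities, `|φ_N t| ^ 2 = ∏ (1 + t ^ 2 * c_j ^ 2)⁻¹`, and once all `c_j ^ 2 ≤ 1 / 2` this is at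
most `(1 + t ^ 2 / 2)⁻²` (`norm_expSumCharFun_le`). Dominated convergence then gives convergence in
`L¹`, and Fourier inversion turns the `L¹` distance into a bound on the difference of the densities
(`ae_mul_abs_pdf_sub_gaussianPDFReal_le`).

The distribution functions follow by Scheffé's argument: the difference of the densities has
integral zero, so only its negative part matters, and that part lies below the Gaussian density
(`abs_cdf_sub_cdf_le`). The Lindeberg condition is separate and comes from fourth moments. -/

/-! ### Moments and characteristic function of the exponential law -/

lemma integral_expMeasure {E : Type*} [NormedAddCommGroup E] [NormedSpace ℝ E] {r : ℝ}
    (hr : 0 < r) (g : ℝ → E) :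
    ∫ x, g x ∂expMeasure r = ∫ x in Set.Ioi 0, (r * Real.exp (-(r * x))) • g x := by
  have hm : Measurable (gammaPDF 1 r) := (measurable_gammaPDFReal 1 r).ennreal_ofReal
  rw [expMeasure, gammaMeasure, integral_withDensity_eq_integral_toReal_smul hm
    (ae_of_all _ fun x => by simp [gammaPDF]), ← integral_Ici_eq_integral_Ioi,
    ← integral_indicator measurableSet_Ici]
  congr 1 with x
  by_cases hx : 0 ≤ x
  · rw [Set.indicator_of_mem (Set.mem_Ici.2 hx), gammaPDF_of_nonneg hx, ENNReal.toReal_ofReal]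
    · simp
    · simp only [Real.rpow_one, Real.Gamma_one, div_one, sub_self, Real.rpow_zero, mul_one]
      positivity
  · rw [Set.indicator_of_notMem (by simpa using hx), gammaPDF_of_neg (not_le.1 hx)]
    simp

lemma integral_pow_expMeasure {r : ℝ} (hr : 0 < r) (n : ℕ) :
    ∫ x, x ^ n ∂expMeasure r = n.factorial / r ^ n := by
  rw [integral_expMeasure hr]
  have h := Real.integral_rpow_mul_exp_neg_mul_Ioi (a := n + 1) (by positivity) hr
  simp only [add_sub_cancel_right, Real.rpow_natCast] at h
  simp only [smul_eq_mul, mul_assoc, integral_const_mul]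
  rw [show (fun x : ℝ => Real.exp (-(r * x)) * x ^ n) = fun x => x ^ n * Real.exp (-(r * x)) by
    ext; ring, h, Real.Gamma_nat_eq_factorial, ← Nat.cast_add_one, Real.rpow_natCast]
  field_simp
  rw [pow_succ, one_div, inv_pow]
  field_simp

lemma integrable_pow_expMeasure {r : ℝ} (hr : 0 < r) (n : ℕ) :
    Integrable (fun x => x ^ n) (expMeasure r) := by
  -- A non-integrable function has integral 0 by convention, whereas this integral is `n! / r ^ n ≠
  -- 0`.
  refine not_imp_comm.1 integral_undef ?_
  rw [integral_pow_expMeasure hr]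
  positivity

lemma memLp_id_expMeasure {r : ℝ} (hr : 0 < r) : MemLp (fun x : ℝ => x) 2 (expMeasure r) :=
  (memLp_two_iff_integrable_sq (by fun_prop)).2 (integrable_pow_expMeasure hr 2)

lemma variance_id_expMeasure {r : ℝ} (hr : 0 < r) :
    variance (fun x : ℝ => x) (expMeasure r) = 1 / r ^ 2 := by
  have := isProbabilityMeasure_expMeasure hr
  have h1 := integral_pow_expMeasure hr 1
  have h2 := integral_pow_expMeasure hr 2
  rw [variance_eq_sub (memLp_id_expMeasure hr)]
  simp only [Pi.pow_apply, pow_one, Nat.factorial] at *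
  rw [h1, h2]
  field_simp
  norm_num

lemma integrable_sub_pow_four_expMeasure {r : ℝ} (hr : 0 < r) (c : ℝ) :
    Integrable (fun x : ℝ => (x - c) ^ 4) (expMeasure r) := by
  have h := integrable_pow_expMeasure hr
  have := isProbabilityMeasure_expMeasure hr
  convert! ((((h 4).sub ((h 3).const_mul (4 * c))).add ((h 2).const_mul (6 * c ^ 2))).sub
    ((h 1).const_mul (4 * c ^ 3))).add (integrable_const (c ^ 4)) using 2 with x
  simp only [Pi.sub_apply, Pi.add_apply]
  ring

/-- The fourth central moment of the exponential law. -/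
lemma integral_sub_pow_four_expMeasure {r : ℝ} (hr : 0 < r) :
    ∫ x, (x - 1 / r) ^ 4 ∂expMeasure r = 9 / r ^ 4 := by
  have h := integrable_pow_expMeasure hr
  have := isProbabilityMeasure_expMeasure hr
  have e : (fun x : ℝ => (x - 1 / r) ^ 4) = fun x => x ^ 4 - 4 * (1 / r) * x ^ 3
      + 6 * (1 / r) ^ 2 * x ^ 2 - 4 * (1 / r) ^ 3 * x ^ 1 + (1 / r) ^ 4 := by
    ext; ring
  rw [e, integral_add (by fun_prop) (by fun_prop), integral_sub (by fun_prop) (by fun_prop),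
    integral_add (by fun_prop) (by fun_prop), integral_sub (by fun_prop) (by fun_prop)]
  simp only [integral_const_mul, integral_pow_expMeasure hr, integral_const, probReal_univ,
    smul_eq_mul, one_mul, Nat.factorial]
  field_simp
  norm_num

lemma charFun_expMeasure {r : ℝ} (hr : 0 < r) (t : ℝ) :
    charFun (expMeasure r) t = 1 / (1 - (t / r : ℝ) * Complex.I) := by
  rw [charFun_apply_real, integral_expMeasure hr]
  have hre : (-r + t * Complex.I : ℂ).re < 0 := by simpa using hr
  have h := integral_exp_mul_complex_Ioi hre 0
  have e : ∀ x : ℝ, (r * Real.exp (-(r * x))) • Complex.exp (t * x * Complex.I)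
      = r * Complex.exp ((-r + t * Complex.I) * x) := by
    intro x
    rw [Complex.real_smul, Complex.ofReal_mul, Complex.ofReal_exp, mul_assoc, ← Complex.exp_add]
    congr 2
    push_cast
    ring
  simp only [e]
  rw [integral_const_mul, h]
  have h0 : (-r + t * Complex.I : ℂ) ≠ 0 := fun h0 => by rw [h0] at hre; simp at hre
  have hr' : (r : ℂ) ≠ 0 := by exact_mod_cast hr.ne'
  have h1 : (r - t * Complex.I : ℂ) ≠ 0 := fun h1 => h0 (by linear_combination -h1)
  have h2 : (1 - (t / r : ℝ) * Complex.I : ℂ) = (r - t * Complex.I) / r := by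
    push_cast; field_simp
  rw [h2, one_div_div, Complex.ofReal_zero, mul_zero, Complex.exp_zero]
  field_simp
  ring

/-! ### Convergence of the normalized characteristic functions -/

/-- The characteristic function of `∑ c i * (E i - 1)` for independent standard exponential
variables `E i`. -/
noncomputable def expSumCharFun (c : ℕ → ℝ) (N : ℕ) (t : ℝ) : ℂ :=
  ∏ i ∈ Finset.range N,
    Complex.exp (-(t * c i : ℝ) * Complex.I) / (1 - (t * c i : ℝ) * Complex.I)

lemma one_sub_ofReal_mul_I_ne_zero (u : ℝ) : (1 - u * Complex.I : ℂ) ≠ 0 := fun h => by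
  simpa using congrArg Complex.re h

lemma continuous_expSumCharFun (c : ℕ → ℝ) (N : ℕ) : Continuous (expSumCharFun c N) := by
  unfold expSumCharFun
  refine continuous_finsetProd _ fun i _ => Continuous.div (by fun_prop) (by fun_prop)
    fun t => one_sub_ofReal_mul_I_ne_zero _

/-- Only the elementary symmetric polynomials of degree at most two are kept, since `(∑ a) ^ 2 - ∑ a
^ 2` is twice the second one. The first conjunct gives the sign of the cubic term dropped in the
induction. -/
lemma le_prod_one_add_mul {ι : Type*} (S : Finset ι) (a : ι → ℝ) (ha : ∀ i ∈ S, 0 ≤ a i) {s : ℝ}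
    (hs : 0 ≤ s) :
    ∑ i ∈ S, a i ^ 2 ≤ (∑ i ∈ S, a i) ^ 2 ∧
    1 + s * ∑ i ∈ S, a i + s ^ 2 / 2 * ((∑ i ∈ S, a i) ^ 2 - ∑ i ∈ S, a i ^ 2)
      ≤ ∏ i ∈ S, (1 + s * a i) := by
  classical
  induction S using Finset.induction_on with
  | empty => simp
  | insert i S hi ih =>
    obtain ⟨h1, h2⟩ := ih fun j hj => ha j (Finset.mem_insert_of_mem hj)
    have hx : 0 ≤ a i := ha i (Finset.mem_insert_self i S)
    have hA : 0 ≤ ∑ j ∈ S, a j :=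
      Finset.sum_nonneg fun j hj => ha j (Finset.mem_insert_of_mem hj)
    rw [Finset.sum_insert hi, Finset.sum_insert hi, Finset.prod_insert hi]
    set A := ∑ j ∈ S, a j
    set B := ∑ j ∈ S, a j ^ 2
    refine ⟨by nlinarith [mul_nonneg hx hA], ?_⟩
    have h3 := mul_le_mul_of_nonneg_left h2 (by positivity : 0 ≤ 1 + s * a i)
    have h4 : 0 ≤ s * a i * (s ^ 2 / 2 * (A ^ 2 - B)) :=
      mul_nonneg (by positivity) (mul_nonneg (by positivity) (by linarith))
    nlinarith

/-- A bound on the characteristic function by an integrable function which does not depend on `c`. -/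
lemma norm_expSumCharFun_le {c : ℕ → ℝ} {N : ℕ} (hc : ∑ i ∈ Finset.range N, c i ^ 2 = 1)
    (hc' : ∀ i ∈ Finset.range N, c i ^ 2 ≤ 1 / 2) (t : ℝ) :
    ‖expSumCharFun c N t‖ ≤ (1 + t ^ 2 / 2)⁻¹ := by
  have hn : ∀ u : ℝ, ‖(1 - u * Complex.I : ℂ)‖ ^ 2 = 1 + u ^ 2 := fun u => by
    rw [Complex.sq_norm, Complex.normSq_apply]; simp; ring
  have h := (le_prod_one_add_mul (Finset.range N) (fun i => c i ^ 2) (fun i _ => sq_nonneg _)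
    (sq_nonneg t)).2
  have hB : ∑ i ∈ Finset.range N, (c i ^ 2) ^ 2 ≤ 1 / 2 := by
    calc ∑ i ∈ Finset.range N, (c i ^ 2) ^ 2 ≤ ∑ i ∈ Finset.range N, 1 / 2 * c i ^ 2 :=
          Finset.sum_le_sum fun i hi => by nlinarith [hc' i hi, sq_nonneg (c i)]
      _ = 1 / 2 := by rw [← Finset.mul_sum, hc, mul_one]
  simp only [hc] at h
  -- As `∑ c i ^ 4 ≤ 1 / 2`, the product of squared norms is at least `1 + t ^ 2 + t ^ 4 / 4`, a
  -- perfect square.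
  have h2 : (1 + t ^ 2 / 2) ^ 2
      ≤ (∏ i ∈ Finset.range N, ‖(1 - (t * c i : ℝ) * Complex.I : ℂ)‖) ^ 2 := by
    rw [← Finset.prod_pow]
    simp only [hn, mul_pow]
    nlinarith [sq_nonneg (t ^ 2)]
  have h3 := le_of_sq_le_sq h2 (Finset.prod_nonneg fun i _ => norm_nonneg _)
  have e : ‖expSumCharFun c N t‖
      = (∏ i ∈ Finset.range N, ‖(1 - (t * c i : ℝ) * Complex.I : ℂ)‖)⁻¹ := by
    rw [expSumCharFun, norm_prod, ← Finset.prod_inv_distrib]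
    refine Finset.prod_congr rfl fun i _ => ?_
    rw [norm_div, ← Complex.ofReal_neg, Complex.norm_exp_ofReal_mul_I, one_div]
  rw [e]
  exact inv_anti₀ (by positivity) h3

/-- Taylor's formula for `log (1 + z)` at `z = -i u`; the remainder is at most `|u| ^ 3 / (3 * (1 -
|u|))`, and `1 - |u| ≥ 1 / 2`. -/
lemma norm_neg_sub_log_add_le {u : ℝ} (hu : |u| ≤ 1 / 2) :
    ‖-(u : ℂ) * Complex.I - Complex.log (1 - u * Complex.I) + u ^ 2 / 2‖ ≤ |u| ^ 3 := by
  have hz : ‖-(u : ℂ) * Complex.I‖ = |u| := by simp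
  have h := Complex.norm_log_sub_logTaylor_le 2 (z := -(u : ℂ) * Complex.I) (by rw [hz]; linarith)
  have e : -(u : ℂ) * Complex.I - Complex.log (1 - u * Complex.I) + u ^ 2 / 2
      = -(Complex.log (1 + -(u : ℂ) * Complex.I)
        - Complex.logTaylor (2 + 1) (-(u : ℂ) * Complex.I)) := by
    rw [sub_eq_add_neg (1 : ℂ), ← neg_mul]
    simp only [Complex.logTaylor_succ, Complex.logTaylor_zero, Pi.add_apply]
    push_cast
    linear_combination ((u : ℂ) ^ 2 / 2) * Complex.I_sq
  rw [e, norm_neg]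
  refine h.trans ?_
  rw [hz]
  have h1 : (1 - |u|)⁻¹ ≤ 2 := by
    rw [inv_le_comm₀ (by linarith) (by norm_num)]; linarith
  have h0 := abs_nonneg u
  norm_num
  nlinarith [mul_le_mul_of_nonneg_left h1 (pow_nonneg h0 3), pow_nonneg h0 3]

/-- The quadratic terms of the logarithms add up to `-t ^ 2 / 2` exactly. Each cubic error is at
most `|t| ^ 3 * δ N * c N i ^ 2`, so together they are at most `|t| ^ 3 * δ N`. -/
lemma tendsto_expSumCharFun {c : ℕ → ℕ → ℝ} {δ : ℕ → ℝ}
    (hc : ∀ᶠ N in atTop, ∑ i ∈ Finset.range N, c N i ^ 2 = 1)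
    (hδ : Tendsto δ atTop (𝓝 0)) (hcδ : ∀ N, ∀ i ∈ Finset.range N, |c N i| ≤ δ N) (t : ℝ) :
    Tendsto (fun N => expSumCharFun (c N) N t) atTop (𝓝 (Complex.exp (-(t ^ 2 / 2 : ℝ)))) := by
  let L : ℕ → ℂ := fun N => ∑ i ∈ Finset.range N, (-((t * c N i : ℝ) : ℂ) * Complex.I
    - Complex.log (1 - (t * c N i : ℝ) * Complex.I))
  have hL : ∀ N, expSumCharFun (c N) N t = Complex.exp (L N) := fun N => by
    rw [expSumCharFun, Complex.exp_sum]
    refine Finset.prod_congr rfl fun i _ => ?_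
    rw [Complex.exp_sub, Complex.exp_log (one_sub_ofReal_mul_I_ne_zero _)]
  simp only [hL]
  refine (Complex.continuous_exp.tendsto _).comp ?_
  rw [tendsto_iff_norm_sub_tendsto_zero]
  have hb : Tendsto (fun N => |t| ^ 3 * δ N) atTop (𝓝 0) := by simpa using hδ.const_mul (|t| ^ 3)
  have ht : Tendsto (fun N => |t| * δ N) atTop (𝓝 0) := by simpa using hδ.const_mul |t|
  refine squeeze_zero' (Eventually.of_forall fun _ => norm_nonneg _) ?_ hb
  filter_upwards [hc, ht.eventually_le_const (by norm_num : (0 : ℝ) < 1 / 2)] with N hN hN'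
  have e : L N - ((-(t ^ 2 / 2) : ℝ) : ℂ)
      = ∑ i ∈ Finset.range N, (-((t * c N i : ℝ) : ℂ) * Complex.I
      - Complex.log (1 - (t * c N i : ℝ) * Complex.I) + ((t * c N i : ℝ) : ℂ) ^ 2 / 2) := by
    rw [Finset.sum_add_distrib, ← Finset.sum_div]
    have : ∑ i ∈ Finset.range N, ((t * c N i : ℝ) : ℂ) ^ 2 = t ^ 2 := by
      simp only [← Complex.ofReal_pow, mul_pow]
      rw [← Complex.ofReal_sum, ← Finset.mul_sum, hN, mul_one]
    rw [this]
    push_cast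
    simp [L]
  have hle : ∀ i ∈ Finset.range N, ‖-((t * c N i : ℝ) : ℂ) * Complex.I
      - Complex.log (1 - (t * c N i : ℝ) * Complex.I) + ((t * c N i : ℝ) : ℂ) ^ 2 / 2‖
      ≤ |t| ^ 3 * δ N * c N i ^ 2 := fun i hi => by
    have h1 := hcδ N i hi
    refine (norm_neg_sub_log_add_le (u := t * c N i) ?_).trans ?_
    · rw [abs_mul]
      exact (mul_le_mul_of_nonneg_left h1 (abs_nonneg t)).trans hN'
    · rw [abs_mul, mul_pow, pow_succ |c N i|, sq_abs, mul_assoc]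
      refine mul_le_mul_of_nonneg_left ?_ (by positivity)
      rw [mul_comm]
      exact mul_le_mul_of_nonneg_right h1 (sq_nonneg _)
  calc _ = ‖L N - ((-(t ^ 2 / 2) : ℝ) : ℂ)‖ := by push_cast; rfl
    _ ≤ ∑ i ∈ Finset.range N, |t| ^ 3 * δ N * c N i ^ 2 := by
      rw [e]; exact norm_sum_le_of_le _ hle
    _ = |t| ^ 3 * δ N := by rw [← Finset.mul_sum, hN, mul_one]

lemma integrable_inv_one_add_sq_div_two : Integrable fun t : ℝ => (1 + t ^ 2 / 2)⁻¹ := by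
  refine (integrable_inv_one_add_sq.const_mul 2).mono' (by fun_prop) (ae_of_all _ fun t => ?_)
  rw [Real.norm_of_nonneg (by positivity), ← div_eq_mul_inv, inv_eq_one_div,
    div_le_div_iff₀ (by positivity) (by positivity)]
  nlinarith [sq_nonneg t]

lemma integrable_exp_neg_sq_div_two : Integrable fun t : ℝ => Real.exp (-(t ^ 2 / 2)) := by
  convert integrable_exp_neg_mul_sq (b := 1 / 2) (by norm_num) using 3
  ring

lemma integrable_expSumCharFun_sub {c : ℕ → ℝ} {N : ℕ}
    (hc : ∑ i ∈ Finset.range N, c i ^ 2 = 1) (hc' : ∀ i ∈ Finset.range N, c i ^ 2 ≤ 1 / 2) :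
    Integrable fun t : ℝ => expSumCharFun c N t - Complex.exp (-(t ^ 2 / 2 : ℝ)) := by
  refine (integrable_inv_one_add_sq_div_two.mono' (continuous_expSumCharFun c N).aestronglyMeasurable
    (ae_of_all _ fun t => norm_expSumCharFun_le hc hc' t)).sub ?_
  refine integrable_exp_neg_sq_div_two.mono' (by fun_prop) (ae_of_all _ fun t => ?_)
  rw [← Complex.ofReal_neg, Complex.norm_exp_ofReal]

lemma tendsto_integral_norm_expSumCharFun_sub {c : ℕ → ℕ → ℝ} {δ : ℕ → ℝ}
    (hc : ∀ᶠ N in atTop, ∑ i ∈ Finset.range N, c N i ^ 2 = 1)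
    (hδ : Tendsto δ atTop (𝓝 0)) (hcδ : ∀ N, ∀ i ∈ Finset.range N, |c N i| ≤ δ N)
    (hc' : ∀ᶠ N in atTop, ∀ i ∈ Finset.range N, c N i ^ 2 ≤ 1 / 2) :
    Tendsto (fun N => ∫ t : ℝ, ‖expSumCharFun (c N) N t - Complex.exp (-(t ^ 2 / 2 : ℝ))‖) atTop
      (𝓝 0) := by
  rw [show (0 : ℝ) = ∫ _ : ℝ, (0 : ℝ) by simp]
  refine tendsto_integral_filter_of_dominated_convergence
    (fun t => (1 + t ^ 2 / 2)⁻¹ + Real.exp (-(t ^ 2 / 2))) (Eventually.of_forall fun N => ?_) ?_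
    (integrable_inv_one_add_sq_div_two.add integrable_exp_neg_sq_div_two)
    (ae_of_all _ fun t => ?_)
  · exact (((continuous_expSumCharFun _ N).sub (by fun_prop)).norm).aestronglyMeasurable
  · filter_upwards [hc, hc'] with N h1 h2
    refine ae_of_all _ fun t => ?_
    rw [norm_norm]
    refine norm_sub_le_of_le (norm_expSumCharFun_le h1 h2 t) ?_
    rw [← Complex.ofReal_neg, Complex.norm_exp_ofReal]
  · exact tendsto_iff_norm_sub_tendsto_zero.1 (tendsto_expSumCharFun hc hδ hcδ t)

/-! ### Almost everywhere Fourier inversion -/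

open scoped FourierTransform in
/-- Fourier inversion almost everywhere for an integrable function with integrable Fourier
transform, without continuity. -/
lemma ae_eq_fourierInv_fourier {f : ℝ → ℂ} (hf : Integrable f) (hf' : Integrable (𝓕 f)) :
    f =ᵐ[volume] 𝓕⁻ (𝓕 f) := by
  have hc : Continuous (𝓕⁻ (𝓕 f)) := by
    have := VectorFourier.fourierIntegral_continuous (L := -innerₗ ℝ)
      Real.continuous_fourierChar (by fun_prop) hf'
    exact this
  refine ae_eq_of_integral_contDiff_smul_eq hf.locallyIntegrable hc.locallyIntegrable
    fun g hg hgs => ?_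
  -- Inversion holds for the test function `φ`. Moving the transforms across the integral twice
  -- gives `∫ 𝓕⁻ (𝓕 f) φ = ∫ 𝓕 f ψ = ∫ f 𝓕 ψ = ∫ f φ`.
  let φ : SchwartzMap ℝ ℂ := HasCompactSupport.toSchwartzMap (f := fun x => (g x : ℂ))
    (hgs.comp_left Complex.ofReal_zero) (Complex.ofRealCLM.contDiff.comp hg)
  let ψ : SchwartzMap ℝ ℂ := 𝓕⁻ φ
  have hψ : ⇑ψ = 𝓕⁻ ⇑φ := SchwartzMap.fourierInv_coe φ
  have hφ : 𝓕 (⇑ψ) = φ := by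
    rw [← SchwartzMap.fourier_coe, FourierTransform.fourier_fourierInv_eq]
  have h1 : ∫ ξ, 𝓕 f ξ • ψ ξ = ∫ x, f x • 𝓕 (⇑ψ) x := by
    simpa using! VectorFourier.integral_fourierIntegral_smul_eq_flip (L := innerₗ ℝ)
      Real.continuous_fourierChar continuous_inner hf ψ.integrable
  have h2 : ∫ ξ, 𝓕⁻ (𝓕 f) ξ • φ ξ = ∫ x, 𝓕 f x • 𝓕⁻ (⇑φ) x := by
    have h := VectorFourier.integral_fourierIntegral_smul_eq_flip (L := -innerₗ ℝ)
      Real.continuous_fourierChar (by fun_prop) hf' (φ.integrable (μ := volume))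
    rw [show (-innerₗ ℝ).flip = -innerₗ ℝ by ext; simp] at h
    exact h
  rw [hφ] at h1
  rw [← hψ, h1] at h2
  have hφg : ∀ x, φ x = g x := fun _ => rfl
  have e : ∀ u : ℝ → ℂ, ∫ x, g x • u x = ∫ x, u x • φ x := fun u =>
    integral_congr_ae (ae_of_all _ fun x => by simp [hφg, mul_comm])
  rw [e, e, h2]

open scoped FourierTransform in
lemma ae_norm_le_integral_norm_fourier {f : ℝ → ℂ} (hf : Integrable f)
    (hf' : Integrable (𝓕 f)) : ∀ᵐ x, ‖f x‖ ≤ ∫ ξ, ‖𝓕 f ξ‖ := by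
  filter_upwards [ae_eq_fourierInv_fourier hf hf'] with x hx
  rw [hx]
  exact VectorFourier.norm_fourierIntegral_le_integral_norm _ _ (-innerₗ ℝ) _ _

/-! ### Moments of the summands and relative standard deviations -/

lemma inv_sq_pos {b : ℝ} (hb : b ≠ 0) : 0 < 1 / b ^ 2 := by positivity

section Summand

variable {Ω : Type*} [MeasurableSpace Ω] {P : Measure Ω} {Y : Ω → ℝ} {b : ℝ}

lemma memLp_two_of_hasLaw_expMeasure (hb : b ≠ 0) (hY : HasLaw Y (expMeasure (1 / b ^ 2)) P) :
    MemLp Y 2 P := by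
  have h := memLp_id_expMeasure (inv_sq_pos hb)
  rw [← hY.map_eq] at h
  exact h.comp_of_map hY.aemeasurable

lemma integral_of_hasLaw_expMeasure (hb : b ≠ 0) (hY : HasLaw Y (expMeasure (1 / b ^ 2)) P) :
    ∫ ω, Y ω ∂P = b ^ 2 := by
  have h := integral_pow_expMeasure (inv_sq_pos hb) 1
  simp only [pow_one] at h
  rw [hY.integral_eq, h]
  simp

lemma variance_of_hasLaw_expMeasure (hb : b ≠ 0) (hY : HasLaw Y (expMeasure (1 / b ^ 2)) P) :
    variance Y P = b ^ 4 := by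
  rw [hY.variance_eq]
  refine (variance_id_expMeasure (inv_sq_pos hb)).trans ?_
  field_simp

lemma integrable_sub_pow_four_of_hasLaw_expMeasure (hb : b ≠ 0)
    (hY : HasLaw Y (expMeasure (1 / b ^ 2)) P) :
    Integrable (fun ω => (Y ω - b ^ 2) ^ 4) P := by
  have h := integrable_sub_pow_four_expMeasure (inv_sq_pos hb) (b ^ 2)
  rw [← hY.map_eq] at h
  exact h.comp_aemeasurable hY.aemeasurable

lemma integral_sub_pow_four_of_hasLaw_expMeasure (hb : b ≠ 0)
    (hY : HasLaw Y (expMeasure (1 / b ^ 2)) P) :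
    ∫ ω, (Y ω - b ^ 2) ^ 4 ∂P = 9 * b ^ 8 := by
  have h := integral_sub_pow_four_expMeasure (inv_sq_pos hb)
  rw [one_div_one_div, ← hY.integral_comp (by fun_prop)] at h
  refine Eq.trans h ?_
  field_simp

lemma hasPDF_of_hasLaw_expMeasure {r : ℝ} [SFinite P] (hY : HasLaw Y (expMeasure r) P) :
    HasPDF Y P volume := by
  rw [Real.hasPDF_iff, hY.map_eq]
  exact ⟨hY.aemeasurable, withDensity_absolutelyContinuous _ _⟩

end Summand

lemma gaussVar_pos {β : ℕ → ℝ} (hβ : ∀ i, β i ≠ 0) {N : ℕ} (hN : 1 ≤ N) : 0 < gaussVar β N := by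
  refine Finset.sum_pos (fun i _ => ?_) ⟨0, Finset.mem_range.2 hN⟩
  have := hβ i
  positivity

/-- The standard deviations of the summands relative to the one of the sum. -/
noncomputable def relStdDev (β : ℕ → ℝ) (N i : ℕ) : ℝ := β i ^ 2 / √(gaussVar β N)

lemma gaussVar_nonneg (β : ℕ → ℝ) (N : ℕ) : 0 ≤ gaussVar β N :=
  Finset.sum_nonneg fun i _ => by positivity

lemma relStdDev_sq (β : ℕ → ℝ) (N i : ℕ) : relStdDev β N i ^ 2 = β i ^ 4 / gaussVar β N := by
  rw [relStdDev, div_pow, Real.sq_sqrt (gaussVar_nonneg β N)]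
  ring

lemma sum_relStdDev_sq {β : ℕ → ℝ} (hβ : ∀ i, β i ≠ 0) {N : ℕ} (hN : 1 ≤ N) :
    ∑ i ∈ Finset.range N, relStdDev β N i ^ 2 = 1 := by
  simp only [relStdDev_sq]
  rw [← Finset.sum_div, ← gaussVar, div_self (gaussVar_pos hβ hN).ne']

lemma relStdDev_sq_le (β : ℕ → ℝ) (N i : ℕ) (hi : i ∈ Finset.range N) :
    relStdDev β N i ^ 2 ≤ ⨆ j : Fin N, β j ^ 4 / gaussVar β N := by
  rw [relStdDev_sq]
  exact le_ciSup (f := fun j : Fin N => β j ^ 4 / gaussVar β N) (Set.finite_range _).bddAbove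
    ⟨i, Finset.mem_range.1 hi⟩

lemma abs_relStdDev_le (β : ℕ → ℝ) (N i : ℕ) (hi : i ∈ Finset.range N) :
    |relStdDev β N i| ≤ √(⨆ j : Fin N, β j ^ 4 / gaussVar β N) :=
  Real.abs_le_sqrt (relStdDev_sq_le β N i hi)

/-! ### The sum: moments, characteristic function, central limit theorem, Lindeberg condition -/

section Sum

variable {Ω : Type*} [MeasurableSpace Ω] {P : Measure Ω} {β : ℕ → ℝ} {X : ℕ → Ω → ℝ}

lemma aemeasurable_partialSum (hX : ∀ i, HasLaw (X i) (expMeasure (1 / β i ^ 2)) P) (N : ℕ) :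
    AEMeasurable (partialSum X N) P :=
  Finset.aemeasurable_fun_sum _ fun i _ => (hX i).aemeasurable

lemma memLp_partialSum (hβ : ∀ i, β i ≠ 0)
    (hX : ∀ i, HasLaw (X i) (expMeasure (1 / β i ^ 2)) P) (N : ℕ) :
    MemLp (partialSum X N) 2 P :=
  memLp_finsetSum _ fun i _ => memLp_two_of_hasLaw_expMeasure (hβ i) (hX i)

lemma integral_partialSum [IsFiniteMeasure P] (hβ : ∀ i, β i ≠ 0)
    (hX : ∀ i, HasLaw (X i) (expMeasure (1 / β i ^ 2)) P) (N : ℕ) :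
    ∫ ω, partialSum X N ω ∂P = gaussMean β N := by
  unfold partialSum gaussMean
  rw [integral_finsetSum _ fun i _ =>
    (memLp_two_of_hasLaw_expMeasure (hβ i) (hX i)).integrable (by norm_num)]
  exact Finset.sum_congr rfl fun i _ => integral_of_hasLaw_expMeasure (hβ i) (hX i)

lemma sumVariance_eq_gaussVar (hβ : ∀ i, β i ≠ 0)
    (hX : ∀ i, HasLaw (X i) (expMeasure (1 / β i ^ 2)) P) (N : ℕ) :
    sumVariance P X N = gaussVar β N :=
  Finset.sum_congr rfl fun i _ => variance_of_hasLaw_expMeasure (hβ i) (hX i)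

lemma variance_partialSum [IsProbabilityMeasure P] (hβ : ∀ i, β i ≠ 0)
    (hX : ∀ i, HasLaw (X i) (expMeasure (1 / β i ^ 2)) P) (hindep : iIndepFun X P) (N : ℕ) :
    variance (partialSum X N) P = gaussVar β N := by
  rw [← sumVariance_eq_gaussVar hβ hX N, show partialSum X N = ∑ i ∈ Finset.range N, X i by
    ext; simp [partialSum], IndepFun.variance_sum
    (fun i _ => memLp_two_of_hasLaw_expMeasure (hβ i) (hX i))
    (fun i _ j _ hij => hindep.indepFun hij), sumVariance]

lemma hasPDF_partialSum [IsProbabilityMeasure P]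
    (hX : ∀ i, HasLaw (X i) (expMeasure (1 / β i ^ 2)) P) (hindep : iIndepFun X P) {N : ℕ}
    (hN : 1 ≤ N) : HasPDF (partialSum X N) P volume := by
  -- The induction starts at 1 because the empty sum is a point mass, without density.
  induction N, hN using Nat.le_induction with
  | base =>
    have := hasPDF_of_hasLaw_expMeasure (hX 0)
    convert this
    ext
    simp [partialSum]
  | succ N hN ih =>
    have := hasPDF_of_hasLaw_expMeasure (hX N)
    have h := hindep.indepFun_finsetSum_of_notMem₀ (fun i => (hX i).aemeasurable)
      (Finset.notMem_range_self (n := N))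
    rw [show ∑ i ∈ Finset.range N, X i = partialSum X N by ext; simp [partialSum]] at h
    convert h.add_hasPDF (μ := volume)
    ext
    simp [partialSum, Finset.sum_range_succ]

/-- The mean is split off as a phase: the Gaussian characteristic function carries the same phase,
which disappears on taking norms of the difference. -/
lemma charFun_partialSum [IsProbabilityMeasure P] (hβ : ∀ i, β i ≠ 0)
    (hX : ∀ i, HasLaw (X i) (expMeasure (1 / β i ^ 2)) P) (hindep : iIndepFun X P) {N : ℕ}
    (hN : 1 ≤ N) (t : ℝ) :
    charFun (P.map (partialSum X N)) t = Complex.exp (t * gaussMean β N * Complex.I)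
      * expSumCharFun (relStdDev β N) N (√(gaussVar β N) * t) := by
  have hs : √(gaussVar β N) ≠ 0 := (Real.sqrt_pos.2 (gaussVar_pos hβ hN)).ne'
  have h := (hindep.restrict (Finset.range N)).charFun_map_fun_finsetSum_eq_prod
    (s := Finset.range N) (fun i _ => (hX i).aemeasurable)
  have e : Complex.exp (t * gaussMean β N * Complex.I)
      = ∏ i ∈ Finset.range N, Complex.exp ((t * β i ^ 2 : ℝ) * Complex.I) := by
    rw [← Complex.exp_sum, ← Finset.sum_mul, ← Complex.ofReal_sum, ← Finset.mul_sum, gaussMean]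
    push_cast
    rfl
  change charFun (P.map fun ω => ∑ i ∈ Finset.range N, X i ω) t = _
  rw [h, Finset.prod_apply, e, expSumCharFun, ← Finset.prod_mul_distrib]
  refine Finset.prod_congr rfl fun i _ => ?_
  rw [(hX i).map_eq, charFun_expMeasure (inv_sq_pos (hβ i)),
    show √(gaussVar β N) * t * relStdDev β N i = t * β i ^ 2 by
      rw [relStdDev]; field_simp, ← mul_div_assoc, ← Complex.exp_add, neg_mul, add_neg_cancel,
    Complex.exp_zero, show t / (1 / β i ^ 2) = t * β i ^ 2 by field_simp]

lemma normalizedSum_eq (hβ : ∀ i, β i ≠ 0)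
    (hX : ∀ i, HasLaw (X i) (expMeasure (1 / β i ^ 2)) P) (N : ℕ) :
    normalizedSum P X N = fun ω => 1 / √(gaussVar β N) * (partialSum X N ω - gaussMean β N) := by
  ext ω
  simp only [normalizedSum, sumVariance_eq_gaussVar hβ hX, Finset.sum_sub_distrib, partialSum,
    gaussMean, fun i => integral_of_hasLaw_expMeasure (hβ i) (hX i)]

lemma charFun_normalizedSum [IsProbabilityMeasure P] (hβ : ∀ i, β i ≠ 0)
    (hX : ∀ i, HasLaw (X i) (expMeasure (1 / β i ^ 2)) P) (hindep : iIndepFun X P) {N : ℕ}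
    (hN : 1 ≤ N) (t : ℝ) :
    charFun (P.map (normalizedSum P X N)) t = expSumCharFun (relStdDev β N) N t := by
  have hs : √(gaussVar β N) ≠ 0 := (Real.sqrt_pos.2 (gaussVar_pos hβ hN)).ne'
  have hm := aemeasurable_partialSum hX N
  have h := charFun_partialSum hβ hX hindep hN (t / √(gaussVar β N))
  rw [mul_div_cancel₀ _ hs, charFun_apply_real, integral_map hm (by fun_prop)] at h
  rw [normalizedSum_eq hβ hX, charFun_apply_real, integral_map (by fun_prop) (by fun_prop)]
  have e : ∀ x : ℝ, Complex.exp (t * (1 / √(gaussVar β N) * (x - gaussMean β N) : ℝ) * Complex.I)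
      = Complex.exp (-((t / √(gaussVar β N) : ℝ) * gaussMean β N * Complex.I))
        * Complex.exp ((t / √(gaussVar β N) : ℝ) * x * Complex.I) := fun x => by
    rw [← Complex.exp_add]
    congr 1
    push_cast
    ring
  simp only [e]
  rw [integral_const_mul, h, ← mul_assoc, ← Complex.exp_add, neg_add_cancel, Complex.exp_zero,
    one_mul]

lemma tendstoInDistribution_normalizedSum [IsProbabilityMeasure P] (hβ : ∀ i, β i ≠ 0)
    (hX : ∀ i, HasLaw (X i) (expMeasure (1 / β i ^ 2)) P) (hindep : iIndepFun X P)
    (hdom : Tendsto (fun N : ℕ => ⨆ i : Fin N, β i ^ 4 / gaussVar β N) atTop (𝓝 0)) :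
    TendstoInDistribution (normalizedSum P X) atTop (id : ℝ → ℝ) (fun _ => P)
      (gaussianReal 0 1) where
  forall_aemeasurable N := by
    have hm := aemeasurable_partialSum hX N
    rw [normalizedSum_eq hβ hX]
    fun_prop
  tendsto := by
    -- Lévy's continuity theorem.
    refine ProbabilityMeasure.tendsto_iff_tendsto_charFun.2 fun t => ?_
    have hδ := (Real.continuous_sqrt.tendsto 0).comp hdom
    rw [Real.sqrt_zero] at hδ
    have h := tendsto_expSumCharFun (eventually_atTop.2 ⟨1, fun N hN => sum_relStdDev_sq hβ hN⟩)
      hδ (abs_relStdDev_le β) t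
    have hlim : charFun (Measure.map id (gaussianReal 0 1)) t
        = Complex.exp (-(t ^ 2 / 2 : ℝ)) := by
      rw [Measure.map_id, charFun_gaussianReal]
      simp
    refine (h.congr' ?_).trans_eq (by rw [← hlim]; rfl)
    filter_upwards [eventually_ge_atTop 1] with N hN
    exact (charFun_normalizedSum hβ hX hindep hN t).symm

/-- On the truncation event the squared deviation is at most its fourth power divided by `ε ^ 2 *
σ_N ^ 2`. The fourth central moment is `9 * β i ^ 8 ≤ 9 * D * σ_N ^ 2 * β i ^ 4`, with `D` the
largest variance ratio, so the Lindeberg quotient is at most `9 * D / ε ^ 2`. -/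
lemma lindebergCondition_of_hasLaw_expMeasure (hβ : ∀ i, β i ≠ 0)
    (hX : ∀ i, HasLaw (X i) (expMeasure (1 / β i ^ 2)) P)
    (hdom : Tendsto (fun N : ℕ => ⨆ i : Fin N, β i ^ 4 / gaussVar β N) atTop (𝓝 0)) :
    LindebergCondition P X := by
  intro ε hε
  simp only [sumVariance_eq_gaussVar hβ hX,
    fun i => integral_of_hasLaw_expMeasure (hβ i) (hX i)]
  have hb := hdom.const_mul (9 / ε ^ 2)
  rw [mul_zero] at hb
  refine squeeze_zero' (Eventually.of_forall fun N => ?_) ?_ hb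
  · refine mul_nonneg (one_div_nonneg.2 (gaussVar_nonneg β N)) (Finset.sum_nonneg fun i _ =>
      integral_nonneg fun ω => Set.indicator_nonneg (fun _ _ => sq_nonneg _) _)
  filter_upwards [eventually_ge_atTop 1] with N hN
  have hV := gaussVar_pos hβ hN
  set D := ⨆ i : Fin N, β i ^ 4 / gaussVar β N
  have key : ∀ i ∈ Finset.range N,
      ∫ ω, Set.indicator {ω | ε * √(gaussVar β N) < |X i ω - β i ^ 2|}
        (fun ω => (X i ω - β i ^ 2) ^ 2) ω ∂P ≤ 9 / ε ^ 2 * D * β i ^ 4 := fun i hi => by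
    have hD : β i ^ 4 ≤ D * gaussVar β N := by
      rw [← div_le_iff₀ hV, ← relStdDev_sq]
      exact relStdDev_sq_le β N i hi
    have h4 : ∫ ω, Set.indicator {ω | ε * √(gaussVar β N) < |X i ω - β i ^ 2|}
        (fun ω => (X i ω - β i ^ 2) ^ 2) ω ∂P
        ≤ ∫ ω, (ε ^ 2 * gaussVar β N)⁻¹ * (X i ω - β i ^ 2) ^ 4 ∂P := by
      refine integral_mono_of_nonneg
        (ae_of_all _ fun ω => Set.indicator_nonneg (fun _ _ => sq_nonneg _) _)
        ((integrable_sub_pow_four_of_hasLaw_expMeasure (hβ i) (hX i)).const_mul _)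
        (ae_of_all _ fun ω => ?_)
      simp only [Set.indicator_apply, Set.mem_ofPred_eq]
      split_ifs with hω
      swap
      · positivity
      have h1 : ε ^ 2 * gaussVar β N ≤ (X i ω - β i ^ 2) ^ 2 := by
        rw [← sq_abs (X i ω - β i ^ 2), ← Real.sq_sqrt hV.le, ← mul_pow]
        exact pow_le_pow_left₀ (by positivity) hω.le 2
      rw [inv_mul_eq_div, le_div_iff₀ (by positivity)]
      nlinarith [mul_le_mul_of_nonneg_left h1 (sq_nonneg (X i ω - β i ^ 2))]
    refine h4.trans ?_
    rw [integral_const_mul, integral_sub_pow_four_of_hasLaw_expMeasure (hβ i) (hX i),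
      inv_mul_eq_div, div_le_iff₀ (by positivity)]
    have : 9 / ε ^ 2 * D * β i ^ 4 * (ε ^ 2 * gaussVar β N) = 9 * β i ^ 4 * (D * gaussVar β N) := by
      field_simp
    rw [this]
    nlinarith [mul_le_mul_of_nonneg_left hD (by positivity : 0 ≤ 9 * β i ^ 4)]
  calc _ ≤ 1 / gaussVar β N * ∑ i ∈ Finset.range N, 9 / ε ^ 2 * D * β i ^ 4 :=
        mul_le_mul_of_nonneg_left (Finset.sum_le_sum key) (by positivity)
    _ = 9 / ε ^ 2 * D := by
      rw [← Finset.mul_sum, ← gaussVar]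
      field_simp

end Sum

/-! ### Local limit theorem for the densities -/

open scoped FourierTransform in
lemma fourier_ofReal_apply (f : ℝ → ℝ) (ξ : ℝ) :
    𝓕 (fun x => (f x : ℂ)) ξ
      = ∫ x, f x • Complex.exp ((-(2 * Real.pi * ξ) : ℝ) * x * Complex.I) := by
  rw [Real.fourier_real_eq_integral_exp_smul]
  refine integral_congr_ae (ae_of_all _ fun x => ?_)
  simp only [smul_eq_mul, Complex.real_smul]
  rw [mul_comm]
  congr 3
  push_cast
  ring

lemma integral_pdf_smul_cexp {Ω : Type*} [MeasurableSpace Ω] {P : Measure Ω} [IsFiniteMeasure P]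
    {Y : Ω → ℝ} [HasPDF Y P volume] (t : ℝ) :
    ∫ x, (pdf Y P volume x).toReal • Complex.exp (t * x * Complex.I) = charFun (P.map Y) t := by
  rw [pdf.integral_pdf_smul (by fun_prop), charFun_apply_real,
    integral_map (HasPDF.aemeasurable Y P volume) (by fun_prop)]

lemma integral_gaussianPDFReal_smul_cexp (m : ℝ) {v : ℝ≥0} (hv : v ≠ 0) (t : ℝ) :
    ∫ x, gaussianPDFReal m v x • Complex.exp (t * x * Complex.I)
      = Complex.exp (t * m * Complex.I - v * t ^ 2 / 2) := by
  rw [← integral_gaussianReal_eq_integral_smul hv, ← charFun_apply_real, charFun_gaussianReal]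

lemma integrable_toReal_pdf {Ω : Type*} [MeasurableSpace Ω] {P : Measure Ω} [IsFiniteMeasure P]
    {Y : Ω → ℝ} : Integrable (fun x => (pdf Y P volume x).toReal) :=
  Measure.integrable_toReal_rnDeriv

lemma integrable_smul_cexp {f : ℝ → ℝ} (hf : Integrable f) (t : ℝ) :
    Integrable fun x : ℝ => f x • Complex.exp (t * x * Complex.I) := by
  refine hf.norm.mono' (hf.aestronglyMeasurable.smul (by fun_prop)) (ae_of_all _ fun x => ?_)
  rw [norm_smul, ← Complex.ofReal_mul, Complex.norm_exp_ofReal_mul_I, mul_one]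

section Sum

variable {Ω : Type*} [MeasurableSpace Ω] {P : Measure Ω} [IsProbabilityMeasure P]
  {β : ℕ → ℝ} {X : ℕ → Ω → ℝ}

lemma toNNReal_gaussVar_ne_zero (hβ : ∀ i, β i ≠ 0) {N : ℕ} (hN : 1 ≤ N) :
    (gaussVar β N).toNNReal ≠ 0 := (Real.toNNReal_pos.2 (gaussVar_pos hβ hN)).ne'

open scoped FourierTransform in
-- The kernel `exp (-2 π i ξ x)` makes the transform at `ξ` a characteristic function at `-2 π ξ`;
-- normalizing multiplies this argument by `σ_N`.
lemma norm_fourier_pdf_sub_gaussianPDFReal (hβ : ∀ i, β i ≠ 0)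
    (hX : ∀ i, HasLaw (X i) (expMeasure (1 / β i ^ 2)) P) (hindep : iIndepFun X P) {N : ℕ}
    (hN : 1 ≤ N) (ξ : ℝ) :
    ‖𝓕 (fun y => (((pdf (partialSum X N) P volume y).toReal
        - gaussianPDFReal (gaussMean β N) (gaussVar β N).toNNReal y : ℝ) : ℂ)) ξ‖
      = ‖expSumCharFun (relStdDev β N) N (-(2 * Real.pi * √(gaussVar β N)) * ξ)
        - Complex.exp (-((-(2 * Real.pi * √(gaussVar β N)) * ξ) ^ 2 / 2 : ℝ))‖ := by
  have := hasPDF_partialSum hX hindep hN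
  have hv := toNNReal_gaussVar_ne_zero hβ hN
  have hV := gaussVar_nonneg β N
  rw [fourier_ofReal_apply]
  simp only [sub_smul]
  rw [integral_sub (integrable_smul_cexp integrable_toReal_pdf _)
    (integrable_smul_cexp (integrable_gaussianPDFReal _ _) _), integral_pdf_smul_cexp,
    integral_gaussianPDFReal_smul_cexp _ hv, charFun_partialSum hβ hX hindep hN,
    sub_eq_add_neg (_ * Complex.I : ℂ), Complex.exp_add, ← mul_sub, norm_mul,
    ← Complex.ofReal_mul, Complex.norm_exp_ofReal_mul_I, one_mul,
    Real.coe_toNNReal _ hV]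
  congr 3
  · ring
  · have h : ((√(gaussVar β N) : ℝ) : ℂ) ^ 2 = gaussVar β N := by
      rw [← Complex.ofReal_pow, Real.sq_sqrt hV]
    push_cast
    linear_combination (2 * (Real.pi : ℂ) ^ 2 * ξ ^ 2) * h

/-- The distance in `L¹` between the characteristic function of the normalized sum and the one of
the standard normal law. -/
noncomputable def charFunDist (β : ℕ → ℝ) (N : ℕ) : ℝ :=
  ∫ t : ℝ, ‖expSumCharFun (relStdDev β N) N t - Complex.exp (-(t ^ 2 / 2 : ℝ))‖

lemma charFunDist_nonneg (β : ℕ → ℝ) (N : ℕ) : 0 ≤ charFunDist β N :=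
  integral_nonneg fun _ => norm_nonneg _

lemma eventually_relStdDev_sq_le
    (hdom : Tendsto (fun N : ℕ => ⨆ i : Fin N, β i ^ 4 / gaussVar β N) atTop (𝓝 0)) :
    ∀ᶠ N in atTop, ∀ i ∈ Finset.range N, relStdDev β N i ^ 2 ≤ 1 / 2 := by
  filter_upwards [hdom.eventually_le_const (by norm_num : (0 : ℝ) < 1 / 2)] with N hN i hi
  exact (relStdDev_sq_le β N i hi).trans hN

lemma tendsto_charFunDist (hβ : ∀ i, β i ≠ 0)
    (hdom : Tendsto (fun N : ℕ => ⨆ i : Fin N, β i ^ 4 / gaussVar β N) atTop (𝓝 0)) :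
    Tendsto (charFunDist β) atTop (𝓝 0) := by
  have hδ := (Real.continuous_sqrt.tendsto 0).comp hdom
  rw [Real.sqrt_zero] at hδ
  exact tendsto_integral_norm_expSumCharFun_sub
    (eventually_atTop.2 ⟨1, fun N hN => sum_relStdDev_sq hβ hN⟩) hδ (abs_relStdDev_le β)
    (eventually_relStdDev_sq_le hdom)

open scoped FourierTransform in
/-- Local limit bound: the densities of the sum and of the Gaussian law differ, at the scale of the
standard deviation, by at most the `L¹` distance of the characteristic functions. -/
lemma ae_mul_abs_pdf_sub_gaussianPDFReal_le (hβ : ∀ i, β i ≠ 0)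
    (hX : ∀ i, HasLaw (X i) (expMeasure (1 / β i ^ 2)) P) (hindep : iIndepFun X P) {N : ℕ}
    (hN : 1 ≤ N) (hle : ∀ i ∈ Finset.range N, relStdDev β N i ^ 2 ≤ 1 / 2) :
    ∀ᵐ y, √(gaussVar β N) * |(pdf (partialSum X N) P volume y).toReal
        - gaussianPDFReal (gaussMean β N) (gaussVar β N).toNNReal y| ≤ charFunDist β N := by
  have hs : 0 < √(gaussVar β N) := Real.sqrt_pos.2 (gaussVar_pos hβ hN)
  have hπ := Real.pi_pos
  have hk : -(2 * Real.pi * √(gaussVar β N)) ≠ 0 := neg_ne_zero.2 (by positivity)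
  have hint := integrable_expSumCharFun_sub (sum_relStdDev_sq hβ hN) hle
  set h : ℝ → ℝ := fun y => (pdf (partialSum X N) P volume y).toReal
        - gaussianPDFReal (gaussMean β N) (gaussVar β N).toNNReal y with hh
  have hhi : Integrable (fun y => (h y : ℂ)) :=
    (integrable_toReal_pdf.sub (integrable_gaussianPDFReal _ _)).ofReal
  have hn : ∀ ξ, ‖𝓕 (fun y => (h y : ℂ)) ξ‖ = _ :=
    norm_fourier_pdf_sub_gaussianPDFReal hβ hX hindep hN
  have hFc : Continuous (𝓕 (fun y => (h y : ℂ))) :=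
    VectorFourier.fourierIntegral_continuous (L := innerₗ ℝ) Real.continuous_fourierChar
      continuous_inner hhi
  have hFi : Integrable (𝓕 (fun y => (h y : ℂ))) :=
    (hint.comp_mul_left' hk).mono hFc.aestronglyMeasurable (ae_of_all _ fun ξ => (hn ξ).le)
  filter_upwards [ae_norm_le_integral_norm_fourier hhi hFi] with y hy
  rw [Complex.norm_real, Real.norm_eq_abs] at hy
  simp only [hn] at hy
  -- The substitution `t = -2 π σ_N ξ` produces the factor `1 / (2 π σ_N)`, which cancels the scale
  -- `σ_N`.
  rw [Measure.integral_comp_mul_left (fun t : ℝ => ‖expSumCharFun (relStdDev β N) N t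
    - Complex.exp (-(t ^ 2 / 2 : ℝ))‖), ← charFunDist, smul_eq_mul, abs_inv, abs_neg,
    abs_of_pos (show 0 < 2 * Real.pi * √(gaussVar β N) by positivity)] at hy
  calc √(gaussVar β N) * |h y|
      ≤ √(gaussVar β N) * ((2 * Real.pi * √(gaussVar β N))⁻¹ * charFunDist β N) := by gcongr
    _ = (2 * Real.pi)⁻¹ * charFunDist β N := by field_simp
    _ ≤ 1 * charFunDist β N := by
      refine mul_le_mul_of_nonneg_right ?_ (charFunDist_nonneg β N)
      exact inv_le_one_of_one_le₀ (by linarith [Real.pi_gt_three])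
    _ = charFunDist β N := one_mul _

lemma gaussianPDFReal_toNNReal_gaussVar (β : ℕ → ℝ) (N : ℕ) (y : ℝ) :
    gaussianPDFReal (gaussMean β N) (gaussVar β N).toNNReal y
      = 1 / √(2 * Real.pi * gaussVar β N)
          * Real.exp (-(y - gaussMean β N) ^ 2 / (2 * gaussVar β N)) := by
  rw [gaussianPDFReal, Real.coe_toNNReal _ (gaussVar_nonneg β N), one_div]

lemma tendsto_eLpNorm_pdf_sub (hβ : ∀ i, β i ≠ 0)
    (hX : ∀ i, HasLaw (X i) (expMeasure (1 / β i ^ 2)) P) (hindep : iIndepFun X P)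
    (hdom : Tendsto (fun N : ℕ => ⨆ i : Fin N, β i ^ 4 / gaussVar β N) atTop (𝓝 0)) :
    Tendsto (fun N : ℕ => eLpNorm (fun y : ℝ => √(gaussVar β N) *
      ((pdf (partialSum X N) P volume y).toReal
        - 1 / √(2 * Real.pi * gaussVar β N)
          * Real.exp (-(y - gaussMean β N) ^ 2 / (2 * gaussVar β N)))) ∞ volume) atTop (𝓝 0) := by
  have hD := ENNReal.tendsto_ofReal (tendsto_charFunDist hβ hdom)
  rw [ENNReal.ofReal_zero] at hD
  refine tendsto_of_tendsto_of_tendsto_of_le_of_le' tendsto_const_nhds hD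
    (Eventually.of_forall fun _ => zero_le) ?_
  filter_upwards [eventually_ge_atTop 1, eventually_relStdDev_sq_le hdom] with N hN hle
  -- At exponent `∞` the volume of the line enters with power 0, so its infinite value does no harm.
  refine (eLpNorm_le_of_ae_bound (C := charFunDist β N) ?_).trans (by simp)
  filter_upwards [ae_mul_abs_pdf_sub_gaussianPDFReal_le hβ hX hindep hN hle] with y hy
  rw [← gaussianPDFReal_toNNReal_gaussVar, norm_mul, Real.norm_of_nonneg (Real.sqrt_nonneg _),
    Real.norm_eq_abs]
  exact hy

end Sum

/-! ### Uniform convergence of the distribution functions -/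

/-- Since `h` has total integral zero, its integral over `A` is minus that over `Aᶜ`, so a lower
bound on every set is also an upper bound. -/
lemma abs_setIntegral_le_integral_negPart {h : ℝ → ℝ} (hi : Integrable h) (h0 : ∫ x, h x = 0)
    {A : Set ℝ} (hA : MeasurableSet A) : |∫ x in A, h x| ≤ ∫ x, max (-h x) 0 := by
  have hm : Integrable fun x => max (-h x) 0 := hi.neg.pos_part
  have key : ∀ B : Set ℝ, -∫ x in B, h x ≤ ∫ x, max (-h x) 0 := fun B => by
    rw [← integral_neg]
    exact (setIntegral_mono hi.neg.integrableOn hm.integrableOn fun x => le_max_left _ _).trans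
      (setIntegral_le_integral hm (ae_of_all _ fun x => le_max_right _ _))
  have hadd := integral_add_compl hA hi
  rw [abs_le]
  constructor
  · linarith [key A]
  · linarith [key Aᶜ]

lemma gaussianPDFReal_eq_inv_mul {m v : ℝ} (hv : 0 < v) (y : ℝ) :
    gaussianPDFReal m v.toNNReal y = (√v)⁻¹ * gaussianPDFReal 0 1 ((y - m) / √v) := by
  simp only [gaussianPDFReal, Real.coe_toNNReal _ hv.le, NNReal.coe_one, mul_one, sub_zero,
    div_pow, Real.sq_sqrt hv.le]
  rw [Real.sqrt_mul (by positivity), mul_inv]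
  rw [show -((y - m) ^ 2 / v) / 2 = -(y - m) ^ 2 / (2 * v) by field_simp]
  ring

/-- Standardizing removes the mean and variance, so the bound on the distribution functions depends
on `N` through `δ` only. -/
lemma integral_min_gaussianPDFReal {m v : ℝ} (hv : 0 < v) (δ : ℝ) :
    ∫ y, min (gaussianPDFReal m v.toNNReal y) ((√v)⁻¹ * δ)
      = ∫ z, min (gaussianPDFReal 0 1 z) δ := by
  have hs : 0 < √v := Real.sqrt_pos.2 hv
  have e : ∀ y, min (gaussianPDFReal m v.toNNReal y) ((√v)⁻¹ * δ)
      = (√v)⁻¹ * min (gaussianPDFReal 0 1 ((y - m) / √v)) δ := fun y => by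
    rw [gaussianPDFReal_eq_inv_mul hv, mul_min_of_nonneg _ _ (by positivity)]
  simp only [e]
  rw [integral_const_mul, integral_sub_right_eq_self
    (fun y => min (gaussianPDFReal 0 1 (y / √v)) δ) m,
    Measure.integral_comp_div (fun z => min (gaussianPDFReal 0 1 z) δ), abs_of_pos hs,
    smul_eq_mul, inv_mul_cancel_left₀ hs.ne']

lemma integrable_min_gaussianPDFReal (m : ℝ) (v : ℝ≥0) {δ : ℝ} (hδ : 0 ≤ δ) :
    Integrable fun y => min (gaussianPDFReal m v y) δ := by
  refine (integrable_gaussianPDFReal m v).mono' (by fun_prop) (ae_of_all _ fun y => ?_)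
  rw [Real.norm_of_nonneg (le_min (gaussianPDFReal_nonneg m v y) hδ)]
  exact min_le_left _ _

lemma tendsto_integral_min_gaussianPDFReal {δ : ℕ → ℝ} (h0 : ∀ N, 0 ≤ δ N)
    (hδ : Tendsto δ atTop (𝓝 0)) :
    Tendsto (fun N => ∫ z, min (gaussianPDFReal 0 1 z) (δ N)) atTop (𝓝 0) := by
  refine (tendsto_integral_of_dominated_convergence (F := fun N z =>
    min (gaussianPDFReal 0 1 z) (δ N)) (f := fun _ => 0) (gaussianPDFReal 0 1)
    (fun N => by fun_prop) (integrable_gaussianPDFReal 0 1) (fun N => ae_of_all _ fun z => ?_)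
    (ae_of_all _ fun z => ?_)).trans_eq (by simp)
  · rw [Real.norm_of_nonneg (le_min (gaussianPDFReal_nonneg 0 1 z) (h0 N))]
    exact min_le_left _ _
  · exact squeeze_zero (fun N => le_min (gaussianPDFReal_nonneg 0 1 z) (h0 N))
      (fun N => min_le_right _ _) hδ

section Sum

variable {Ω : Type*} [MeasurableSpace Ω] {P : Measure Ω} [IsProbabilityMeasure P]
  {β : ℕ → ℝ} {X : ℕ → Ω → ℝ}

lemma cdf_map_eq_setIntegral_pdf {Y : Ω → ℝ} [HasPDF Y P volume] (y : ℝ) :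
    cdf (P.map Y) y = ∫ x in Set.Iic y, (pdf Y P volume x).toReal := by
  have := Measure.isProbabilityMeasure_map (HasPDF.aemeasurable Y P volume)
  have hac : P.map Y ≪ volume := HasPDF.absolutelyContinuous
  rw [cdf_eq_real, pdf_def, Measure.setIntegral_toReal_rnDeriv hac]

lemma cdf_gaussianReal_eq_setIntegral (m : ℝ) {v : ℝ≥0} (hv : v ≠ 0) (y : ℝ) :
    cdf (gaussianReal m v) y = ∫ x in Set.Iic y, gaussianPDFReal m v x := by
  rw [cdf_eq_real, measureReal_def, gaussianReal_apply_eq_integral _ hv, ENNReal.toReal_ofReal]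
  exact integral_nonneg fun x => gaussianPDFReal_nonneg _ _ _

/-- With `f` the density of the sum and `g` the Gaussian one, the negative part of `f - g` is at
most `g` because `f ≥ 0`, and at most `charFunDist β N / σ_N` by the local limit bound. -/
lemma abs_cdf_sub_cdf_le (hβ : ∀ i, β i ≠ 0)
    (hX : ∀ i, HasLaw (X i) (expMeasure (1 / β i ^ 2)) P) (hindep : iIndepFun X P) {N : ℕ}
    (hN : 1 ≤ N) (hle : ∀ i ∈ Finset.range N, relStdDev β N i ^ 2 ≤ 1 / 2) (y : ℝ) :
    |cdf (P.map (partialSum X N)) y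
        - cdf (gaussianReal (gaussMean β N) (gaussVar β N).toNNReal) y|
      ≤ ∫ z, min (gaussianPDFReal 0 1 z) (charFunDist β N) := by
  have := hasPDF_partialSum hX hindep hN
  have hv := toNNReal_gaussVar_ne_zero hβ hN
  have hV := gaussVar_pos hβ hN
  have hs := Real.sqrt_pos.2 hV
  have hf : Integrable fun x => (pdf (partialSum X N) P volume x).toReal := integrable_toReal_pdf
  have hg := integrable_gaussianPDFReal (gaussMean β N) (gaussVar β N).toNNReal
  have h0 : ∫ x, ((pdf (partialSum X N) P volume x).toReal
      - gaussianPDFReal (gaussMean β N) (gaussVar β N).toNNReal x) = 0 := by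
    have h1 : ∫ x, (pdf (partialSum X N) P volume x).toReal = 1 := by
      -- The total mass of the density is the characteristic function at 0.
      have h := integral_pdf_smul_cexp (P := P) (Y := partialSum X N) 0
      have := Measure.isProbabilityMeasure_map (aemeasurable_partialSum hX N)
      simpa [integral_complex_ofReal] using h
    rw [integral_sub hf hg, h1, integral_gaussianPDFReal_eq_one _ hv, sub_self]
  rw [cdf_map_eq_setIntegral_pdf, cdf_gaussianReal_eq_setIntegral _ hv,
    ← integral_sub hf.integrableOn hg.integrableOn]
  refine (abs_setIntegral_le_integral_negPart (hf.sub hg) h0 measurableSet_Iic).trans ?_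
  rw [← integral_min_gaussianPDFReal (m := gaussMean β N) hV]
  refine integral_mono_ae (hf.sub hg).neg.pos_part (integrable_min_gaussianPDFReal _ _
    (mul_nonneg (by positivity) (charFunDist_nonneg β N))) ?_
  filter_upwards [ae_mul_abs_pdf_sub_gaussianPDFReal_le hβ hX hindep hN hle] with x hx
  have h1 : 0 ≤ (pdf (partialSum X N) P volume x).toReal := ENNReal.toReal_nonneg
  have h2 := gaussianPDFReal_nonneg (gaussMean β N) (gaussVar β N).toNNReal x
  have h3 := (le_inv_mul_iff₀ hs).2 hx
  have h4 := abs_le.1 h3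
  simp only [Pi.sub_apply]
  refine max_le (le_min (by linarith) (by linarith)) (le_min h2 ?_)
  exact (abs_nonneg _).trans h3

lemma tendsto_iSup_abs_cdf_sub_cdf (hβ : ∀ i, β i ≠ 0)
    (hX : ∀ i, HasLaw (X i) (expMeasure (1 / β i ^ 2)) P) (hindep : iIndepFun X P)
    (hdom : Tendsto (fun N : ℕ => ⨆ i : Fin N, β i ^ 4 / gaussVar β N) atTop (𝓝 0)) :
    Tendsto (fun N : ℕ => ⨆ y : ℝ,
      |cdf (P.map (partialSum X N)) y
        - cdf (gaussianReal (gaussMean β N) (gaussVar β N).toNNReal) y|) atTop (𝓝 0) := by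
  refine squeeze_zero' (Eventually.of_forall fun N => Real.iSup_nonneg fun y => abs_nonneg _) ?_
    (tendsto_integral_min_gaussianPDFReal (charFunDist_nonneg β) (tendsto_charFunDist hβ hdom))
  filter_upwards [eventually_ge_atTop 1, eventually_relStdDev_sq_le hdom] with N hN hle
  exact ciSup_le fun y => abs_cdf_sub_cdf_le hβ hX hindep hN hle y

end Sum

theorem theorem4 {Ω : Type*} [MeasurableSpace Ω] (P : Measure Ω) [IsProbabilityMeasure P]
    (β : ℕ → ℝ) (hβ : ∀ i, β i ≠ 0)
    (X : ℕ → Ω → ℝ)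
    (hX : ∀ i, HasLaw (X i) (expMeasure (1 / β i ^ 2)) P)
    (hindep : iIndepFun X P)
    (hdom : Tendsto (fun N : ℕ => ⨆ i : Fin N, β i ^ 4 / gaussVar β N) atTop (𝓝 0)) :
    -- means and variances of the summands
    (∀ i, MemLp (X i) 2 P ∧ ∫ ω, X i ω ∂P = β i ^ 2 ∧ variance (X i) P = β i ^ 4) ∧
    -- mean and variance of the sum
    (∀ N, MemLp (partialSum X N) 2 P ∧ ∫ ω, partialSum X N ω ∂P = gaussMean β N ∧
      variance (partialSum X N) P = gaussVar β N) ∧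
    -- the Lindeberg condition
    LindebergCondition P X ∧
    -- the normalized sum converges in distribution to the standard normal law
    TendstoInDistribution (normalizedSum P X) atTop (id : ℝ → ℝ) (fun _ => P)
      (gaussianReal 0 1) ∧
    -- the law of the sum is asymptotically Gaussian, uniformly in the distribution functions
    Tendsto (fun N : ℕ => ⨆ y : ℝ,
      |cdf (P.map (partialSum X N)) y
        - cdf (gaussianReal (gaussMean β N) (gaussVar β N).toNNReal) y|) atTop (𝓝 0) ∧
    -- the sum has a density, and it is asymptotically the Gaussian one, uniformly at scale `1 / σ`
    (∀ N, 1 ≤ N → HasPDF (partialSum X N) P volume) ∧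
    Tendsto (fun N : ℕ => eLpNorm (fun y : ℝ => √(gaussVar β N) *
      ((pdf (partialSum X N) P volume y).toReal
        - 1 / √(2 * Real.pi * gaussVar β N)
          * Real.exp (-(y - gaussMean β N) ^ 2 / (2 * gaussVar β N)))) ∞ volume) atTop (𝓝 0) :=
  ⟨fun i => ⟨memLp_two_of_hasLaw_expMeasure (hβ i) (hX i),
      integral_of_hasLaw_expMeasure (hβ i) (hX i), variance_of_hasLaw_expMeasure (hβ i) (hX i)⟩,
    fun N => ⟨memLp_partialSum hβ hX N, integral_partialSum hβ hX N,
      variance_partialSum hβ hX hindep N⟩,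
    lindebergCondition_of_hasLaw_expMeasure hβ hX hdom,
    tendstoInDistribution_normalizedSum hβ hX hindep hdom,
    tendsto_iSup_abs_cdf_sub_cdf hβ hX hindep hdom,
    fun _ hN => hasPDF_partialSum hX hindep hN,
    tendsto_eLpNorm_pdf_sub hβ hX hindep hdom⟩
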